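/- Let $P(x_1,x_2) = (x_1^2+x_2^2)^2 + 18(x_1^2+x_2^2) - 8x_1^3 + 24x_1x_2^2 - 27$, so that $\{P=0\}\subset\mathbb{R}^2$ is the deltoid curve $\theta\mapsto(2\cos\theta+\cos 2\theta,\ 2\sin\theta-\sin 2\theta)$, and let $\Omega$ be the interior of this curve, i.e. the set of points of $\mathbb{R}^2\setminus\{P=0\}$ whose connected component in $\mathbb{R}^2\setminus\{P=0\}$ is bounded. Let $g=(g_{ij})$ be the symmetric $2\times 2$ matrix with entries $$g_{11} = -(3x_1^2-x_2^2-6x_1-9),\qquad g_{12}=g_{21} = -2x_2(2x_1+3),\qquad g_{22} = -(3x_2^2-x_1^2+6x_1-9).$$ Then $\det(g) = -3P$ on $\mathbb{R}^2$ and $\det(g)>0$ on $\Omega$, and for every real number $\alpha$ the function $\det(g)^\alpha$ is integrable on $\Omega$ with respect to the Lebesgue measure if and only if $\alpha > -\tfrac56$. -/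

import Mathlib

/-! In complex notation `P z = |z|⁴ + 18 |z|² - 8 Re z³ - 27`. Since `Re z³ ≤ |z|³`, the function
`P` is nondecreasing along every ray from the origin, with `P 0 = -27`; so a point where `P > 0`
lies in an unbounded component of the complement of the curve, and `Ω = {P < 0}`.

`P` is invariant under `z ↦ ωz` with `ω` a primitive cube root of unity, and one of `z`, `ωz`, `ω²z`
has nonnegative real part, so only the half `0 ≤ x₁` of `Ω` matters, and it contains a single cusp,
`(3, 0)`. Its vertical slices are intervals `|x₂| < w(x₁)` with `w` of order `(3 - x₁)^(3/2)`.

On a slice `-P ≥ w² - x₂²`, so for `-1 < α < 0` the integral of `(-P)^α` over it is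
`O(w^(2α+1))`; for `α ≤ -1/2` this is `O((3 - x₁)^(3α+3/2))`, which is integrable up to the cusp
when `α > -5/6`. At `α = -5/6` the bound `-P ≤ 4 (3 - x₁)³` makes that integral at least a constant
times `(3 - x₁)^(3/2 - 5/2)`, so the double integral diverges. Other exponents compare with these,
`P` being bounded on `Ω`. -/

/-- The quartic polynomial whose zero set in the plane is the deltoid curve. -/
def deltoidP (x : ℝ × ℝ) : ℝ :=
  (x.1 ^ 2 + x.2 ^ 2) ^ 2 + 18 * (x.1 ^ 2 + x.2 ^ 2) - 8 * x.1 ^ 3 + 24 * x.1 * x.2 ^ 2 - 27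

/-- The deltoid curve, with parametrization
`(2 cos θ + cos 2θ, 2 sin θ - sin 2θ)` and equation `deltoidP x = 0`. -/
def deltoidCurve : Set (ℝ × ℝ) := {x | deltoidP x = 0}

/-- The interior of the deltoid curve: the points off the curve that lie in a bounded
connected component of the complement of the curve. -/
def deltoidInterior : Set (ℝ × ℝ) :=
  {x | x ∉ deltoidCurve ∧ Bornology.IsBounded (connectedComponentIn deltoidCurveᶜ x)}

/-- The symmetric matrix `g = (g_ij)` of second order coefficients of the diffusion operators
attached to the deltoid. -/
def deltoidG (x : ℝ × ℝ) : Matrix (Fin 2) (Fin 2) ℝ :=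
  !![-(3 * x.1 ^ 2 - x.2 ^ 2 - 6 * x.1 - 9), -2 * x.2 * (2 * x.1 + 3);
     -2 * x.2 * (2 * x.1 + 3), -(3 * x.2 ^ 2 - x.1 ^ 2 + 6 * x.1 - 9)]

open MeasureTheory Set

section ConnectedComponent

theorem connectedComponentIn_subset_setOf_lt {X α : Type*} [TopologicalSpace X] [LinearOrder α]
    [TopologicalSpace α] [OrderClosedTopology α] {f : X → α} {c : α}
    (hf : ContinuousOn f {y | f y ≠ c}) {x : X} (hx : f x < c) :
    connectedComponentIn {y | f y ≠ c} x ⊆ {y | f y < c} := fun _ hy =>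
  isPreconnected_connectedComponentIn.gt_of_ne (hf.mono (connectedComponentIn_subset _ _))
    (fun _ hz => connectedComponentIn_subset _ _ hz) ⟨x, mem_connectedComponentIn hx.ne, hx⟩ hy

theorem not_isBounded_connectedComponentIn_of_ray {E : Type*} [NormedAddCommGroup E]
    [NormedSpace ℝ E] {s : Set E} {v : E} (hv : v ≠ 0) (hray : ∀ t : ℝ, 1 ≤ t → t • v ∈ s) :
    ¬ Bornology.IsBounded (connectedComponentIn s v) := by
  intro hbdd
  have hsub : (fun t : ℝ => t • v) '' Ici 1 ⊆ connectedComponentIn s v := by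
    refine IsPreconnected.subset_connectedComponentIn ?_ ⟨1, self_mem_Ici, one_smul ℝ v⟩
      (image_subset_iff.2 hray)
    exact isPreconnected_Ici.image _ (by fun_prop)
  obtain ⟨C, hC⟩ := (hbdd.subset hsub).exists_norm_le
  have hv_pos : 0 < ‖v‖ := norm_pos_iff.2 hv
  have ht : 1 ≤ |C| / ‖v‖ + 1 := le_add_of_nonneg_left (by positivity)
  have hle : ‖(|C| / ‖v‖ + 1) • v‖ ≤ C := hC _ (mem_image_of_mem _ ht)
  rw [norm_smul, Real.norm_of_nonneg (by positivity), add_mul, div_mul_cancel₀ _ hv_pos.ne'] at hle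
  linarith [le_abs_self C]

end ConnectedComponent

section Rotation

variable {ζ : ℂ} {n : ℕ}

theorem measurePreserving_mul_left_of_norm_eq_one (hζ : ‖ζ‖ = 1) :
    MeasurePreserving (fun z : ℂ => ζ * z) :=
  (rotation ⟨ζ, mem_sphere_zero_iff_norm.2 hζ⟩).measurePreserving

theorem exists_re_pow_mul_nonneg (hζ : IsPrimitiveRoot ζ n) (hn : 1 < n) (z : ℂ) :
    ∃ k ∈ Finset.range n, 0 ≤ (ζ ^ k * z).re := by
  by_contra! hneg
  have hsum : ∑ k ∈ Finset.range n, (ζ ^ k * z).re = 0 := by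
    rw [← Complex.re_sum, ← Finset.sum_mul, hζ.geom_sum_eq_zero hn, zero_mul, Complex.zero_re]
  exact (Finset.sum_neg hneg ⟨0, Finset.mem_range.2 (by lia)⟩).ne hsum

theorem integrable_of_integrableOn_re_nonneg {E : Type*} [NormedAddCommGroup E] {f : ℂ → E}
    (hζ : IsPrimitiveRoot ζ n) (hn : 1 < n) (hinv : ∀ z, f (ζ * z) = f z)
    (hf : IntegrableOn f {z | 0 ≤ z.re}) : Integrable f := by
  have hinv_pow (k : ℕ) (z : ℂ) : f (ζ ^ k * z) = f z := by
    induction k with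
    | zero => rw [pow_zero, one_mul]
    | succ k ih => rw [pow_succ', mul_assoc, hinv, ih]
  have hcover : ⋃ k ∈ Finset.range n, {z : ℂ | 0 ≤ (ζ ^ k * z).re} = univ :=
    eq_univ_of_forall fun z => by simpa using exists_re_pow_mul_nonneg hζ hn z
  rw [← integrableOn_univ, ← hcover, integrableOn_finset_iUnion]
  intro k _
  have hnorm : ‖ζ ^ k‖ = 1 := by rw [norm_pow, hζ.norm'_eq_one (by lia), one_pow]
  have hpre := (measurePreserving_mul_left_of_norm_eq_one hnorm).integrableOn_comp_preimage
    (measurableEmbedding_mulLeft₀ (norm_ne_zero_iff.1 (by rw [hnorm]; exact one_ne_zero)))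
    (f := f) (s := {z | 0 ≤ z.re})
  simp only [Function.comp_def, hinv_pow] at hpre
  exact hpre.2 hf

end Rotation

section RegionBetween

variable {X : Type*} [MeasurableSpace X] {μ : Measure X} {s : Set X}

theorem integrableOn_regionBetween_iff {E : Type*} [NormedAddCommGroup E] {f : X × ℝ → E}
    {φ ψ : X → ℝ} (hφ : Measurable φ) (hψ : Measurable ψ) (hs : MeasurableSet s)
    (hf : AEStronglyMeasurable f ((μ.prod volume).restrict (regionBetween φ ψ s))) :
    IntegrableOn f (regionBetween φ ψ s) (μ.prod volume) ↔
      (∀ᵐ x ∂μ.restrict s, IntegrableOn (fun y => f (x, y)) (Ioo (φ x) (ψ x))) ∧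
        IntegrableOn (fun x => ∫ y in Ioo (φ x) (ψ x), ‖f (x, y)‖) s μ := by
  have hR := measurableSet_regionBetween hφ hψ hs
  have hslice {x : X} (hx : x ∈ s) : (fun y => (regionBetween φ ψ s).indicator f (x, y)) =
      (Ioo (φ x) (ψ x)).indicator fun y => f (x, y) := by
    ext y
    simp only [indicator, regionBetween, mem_ofPred_eq, hx, true_and]
  have hslice_compl {x : X} (hx : x ∉ s) :
      (fun y => (regionBetween φ ψ s).indicator f (x, y)) = 0 := by
    ext y
    exact indicator_of_notMem (fun h => hx h.1) f
  rw [← integrable_indicator_iff hR,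
    integrable_prod_iff ((aestronglyMeasurable_indicator_iff hR).2 hf), ae_restrict_iff' hs,
    ← integrable_indicator_iff hs]
  refine and_congr (Filter.eventually_congr (ae_of_all _ fun x => ?_))
    (integrable_congr (ae_of_all _ fun x => ?_))
  · by_cases hx : x ∈ s
    · simp only [hslice hx, hx, true_imp_iff, integrable_indicator_iff measurableSet_Ioo]
    · simp only [hslice_compl hx, hx, false_imp_iff, iff_true]
      exact integrable_zero _ _ _
  · by_cases hx : x ∈ s
    · simp only [indicator_of_mem hx, ← integral_indicator measurableSet_Ioo]
      refine integral_congr_ae (ae_of_all _ fun y => ?_)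
      simp only [congrFun (hslice hx) y, norm_indicator_eq_indicator_norm]
    · simp only [congrFun (hslice_compl hx) _, indicator_of_notMem hx, Pi.zero_apply, norm_zero,
        integral_zero]

theorem integrableOn_sub_mul_of_integrableOn_regionBetween {g φ ψ : X → ℝ} (hφ : Measurable φ)
    (hψ : Measurable ψ) (hs : MeasurableSet s) (hle : ∀ x ∈ s, φ x ≤ ψ x)
    (hint : IntegrableOn (fun p => g p.1) (regionBetween φ ψ s) (μ.prod volume)) :
    IntegrableOn (fun x => (ψ x - φ x) * ‖g x‖) s μ := by
  refine ((integrableOn_regionBetween_iff hφ hψ hs hint.aestronglyMeasurable).1 hint).2.congr_fun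
    (fun x hx => ?_) hs
  simp only [setIntegral_const, Real.volume_real_Ioo_of_le (hle x hx), smul_eq_mul]

end RegionBetween

section PowerIntegrals

variable {α : ℝ}

theorem integrableOn_Ico_sub_rpow_iff {a b s : ℝ} (hab : a < b) :
    IntegrableOn (fun x : ℝ => (b - x) ^ s) (Ico a b) ↔ -1 < s := by
  rw [integrableOn_Ico_iff_integrableOn_Ioo,
    ← intervalIntegrable_iff_integrableOn_Ioo_of_le hab.le, IntervalIntegrable.symm_iff]
  have hreflect := IntervalIntegrable.comp_sub_left_iff (f := fun u : ℝ => u ^ s) (a := 0)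
    (b := b - a) b
  rw [sub_zero, sub_sub_cancel] at hreflect
  rw [hreflect, intervalIntegrable_iff_integrableOn_Ioo_of_le (sub_nonneg.2 hab.le),
    intervalIntegral.integrableOn_Ioo_rpow_iff (sub_pos.2 hab)]

theorem intervalIntegrable_rpow_sq_sub_sq (hα : -1 < α) {w : ℝ} (hw : 0 < w) :
    IntervalIntegrable (fun y : ℝ => (w ^ 2 - y ^ 2) ^ α) volume (-w) w := by
  have hright : IntervalIntegrable (fun y : ℝ => (w ^ 2 - y ^ 2) ^ α) volume 0 w := by
    have hsub : IntervalIntegrable (fun y : ℝ => (w - y) ^ α) volume 0 w := by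
      rw [intervalIntegrable_iff_integrableOn_Ico_of_le hw.le]
      exact (integrableOn_Ico_sub_rpow_iff hw).2 hα
    have hadd : ContinuousOn (fun y : ℝ => (w + y) ^ α) (uIcc 0 w) := by
      rw [uIcc_of_le hw.le]
      exact ContinuousOn.rpow_const (by fun_prop) fun y hy => Or.inl (by linarith [hy.1])
    refine (hsub.mul_continuousOn hadd).congr fun y hy => ?_
    rw [uIoc_of_le hw.le] at hy
    rw [← Real.mul_rpow (by linarith [hy.2]) (by linarith [hy.1])]
    ring_nf
  have hleft := (IntervalIntegrable.iff_comp_neg (by finiteness)).1 hright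
  simp only [neg_sq, neg_zero] at hleft
  exact hleft.symm.trans hright

theorem integral_rpow_sq_sub_sq {w : ℝ} (hw : 0 < w) :
    ∫ y in -w..w, (w ^ 2 - y ^ 2) ^ α =
      w ^ (2 * α + 1) * ∫ t in (-1 : ℝ)..1, (1 - t ^ 2) ^ α := by
  have hscale : w * ∫ t in (-1 : ℝ)..1, (w ^ 2 - (w * t) ^ 2) ^ α =
      ∫ y in -w..w, (w ^ 2 - y ^ 2) ^ α := by
    rw [intervalIntegral.mul_integral_comp_mul_left (f := fun y => (w ^ 2 - y ^ 2) ^ α),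
      mul_neg_one, mul_one]
  rw [← hscale, Real.rpow_add_one hw.ne', mul_comm (w ^ (2 * α)) w, mul_assoc,
    ← intervalIntegral.integral_const_mul (w ^ (2 * α))]
  congr 1
  refine intervalIntegral.integral_congr fun t ht => ?_
  rw [uIcc_of_le (by norm_num)] at ht
  have ht_sq : 0 ≤ 1 - t ^ 2 := by nlinarith [ht.1, ht.2]
  rw [Real.rpow_mul hw.le, Real.rpow_two, ← Real.mul_rpow (sq_nonneg w) ht_sq]
  ring_nf

theorem integrableOn_regionBetween_rpow_sq_sub_sq {X : Type*} [MeasurableSpace X] {μ : Measure X}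
    {s : Set X} {w : X → ℝ} (hs : MeasurableSet s) (hw : Measurable w)
    (hw_pos : ∀ x ∈ s, 0 < w x) (hα : -1 < α)
    (hint : IntegrableOn (fun x => w x ^ (2 * α + 1)) s μ) :
    IntegrableOn (fun p : X × ℝ => (w p.1 ^ 2 - p.2 ^ 2) ^ α) (regionBetween (-w) w s)
      (μ.prod volume) := by
  rw [integrableOn_regionBetween_iff hw.neg hw hs (Measurable.aestronglyMeasurable (by fun_prop))]
  constructor
  · refine ae_restrict_of_forall_mem hs fun x hx => ?_
    rw [Pi.neg_apply, ← intervalIntegrable_iff_integrableOn_Ioo_of_le (by linarith [hw_pos x hx])]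
    exact intervalIntegrable_rpow_sq_sub_sq hα (hw_pos x hx)
  · refine IntegrableOn.congr_fun (hint.mul_const (∫ t in (-1 : ℝ)..1, (1 - t ^ 2) ^ α))
      (fun x hx => ?_) hs
    have hx_pos := hw_pos x hx
    simp only
    rw [← integral_rpow_sq_sub_sq hx_pos, intervalIntegral.integral_of_le (by linarith),
      integral_Ioc_eq_integral_Ioo, Pi.neg_apply]
    refine setIntegral_congr_fun measurableSet_Ioo fun y hy => (Real.norm_of_nonneg ?_).symm
    exact Real.rpow_nonneg (by nlinarith [hy.1, hy.2]) _

end PowerIntegrals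

section DeltoidPolynomial

theorem deltoidG_det (x : ℝ × ℝ) : (deltoidG x).det = -3 * deltoidP x := by
  simp only [deltoidG, Matrix.det_fin_two_of, deltoidP]
  ring

@[fun_prop]
theorem continuous_deltoidP : Continuous deltoidP := by
  unfold deltoidP
  fun_prop

theorem deltoidP_re_im (z : ℂ) :
    deltoidP (z.re, z.im) = ‖z‖ ^ 4 + 18 * ‖z‖ ^ 2 - 8 * (z ^ 3).re - 27 := by
  have hnorm : ‖z‖ ^ 2 = z.re ^ 2 + z.im ^ 2 := by
    rw [Complex.sq_norm, Complex.normSq_apply, sq, sq]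
  have hcube : (z ^ 3).re = z.re ^ 3 - 3 * z.re * z.im ^ 2 := by
    simp only [pow_succ, pow_zero, one_mul, Complex.mul_re, Complex.mul_im]
    ring
  rw [show ‖z‖ ^ 4 = (‖z‖ ^ 2) ^ 2 by ring, hnorm, hcube, deltoidP]
  ring

theorem re_pow_le_norm_pow (z : ℂ) (n : ℕ) : (z ^ n).re ≤ ‖z‖ ^ n :=
  (Complex.re_le_norm _).trans_eq (norm_pow z n)

theorem deltoidP_re_im_mul_of_cube_eq_one {ζ : ℂ} (hζ : ζ ^ 3 = 1) (z : ℂ) :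
    deltoidP ((ζ * z).re, (ζ * z).im) = deltoidP (z.re, z.im) := by
  rw [deltoidP_re_im, deltoidP_re_im, norm_mul, mul_pow ζ z 3, hζ, one_mul,
    Complex.norm_eq_one_of_pow_eq_one hζ three_ne_zero, one_mul]

theorem deltoidP_smul (t : ℝ) (z : ℂ) :
    deltoidP (t • (z.re, z.im)) =
      t ^ 4 * ‖z‖ ^ 4 + 18 * t ^ 2 * ‖z‖ ^ 2 - 8 * t ^ 3 * (z ^ 3).re - 27 := by
  have hsmul : t • (z.re, z.im) = ((t * z : ℂ).re, (t * z : ℂ).im) := by simp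
  rw [hsmul, deltoidP_re_im, norm_mul, mul_pow (t : ℂ) z 3, ← Complex.ofReal_pow,
    Complex.re_ofReal_mul, mul_pow, mul_pow, Complex.norm_real, Real.norm_eq_abs, sq_abs,
    Even.pow_abs (by decide)]
  ring

theorem monotoneOn_deltoidP_ray (p : ℝ × ℝ) :
    MonotoneOn (fun t : ℝ => deltoidP (t • p)) (Ici 0) := by
  let z : ℂ := ⟨p.1, p.2⟩
  have hderiv (t : ℝ) : HasDerivAt (fun t : ℝ => deltoidP (t • p))
      (4 * t ^ 3 * ‖z‖ ^ 4 + 36 * t * ‖z‖ ^ 2 - 24 * t ^ 2 * (z ^ 3).re) t := by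
    have hfun : (fun t : ℝ => deltoidP (t • p)) = fun t =>
        t ^ 4 * ‖z‖ ^ 4 + 18 * t ^ 2 * ‖z‖ ^ 2 - 8 * t ^ 3 * (z ^ 3).re - 27 :=
      funext fun t => deltoidP_smul t z
    rw [hfun]
    refine (((((hasDerivAt_pow 4 t).mul_const _).add
      (((hasDerivAt_pow 2 t).const_mul 18).mul_const _)).sub
      (((hasDerivAt_pow 3 t).const_mul 8).mul_const _)).sub_const 27).congr_deriv ?_
    simp only [Nat.cast_ofNat]
    ring
  refine monotoneOn_of_deriv_nonneg (convex_Ici 0)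
    (fun t _ => (hderiv t).continuousAt.continuousWithinAt)
    (fun t _ => (hderiv t).differentiableAt.differentiableWithinAt) fun t ht => ?_
  rw [interior_Ici, mem_Ioi] at ht
  rw [(hderiv t).deriv]
  calc (0 : ℝ) ≤ 4 * t * ‖z‖ ^ 2 * (t * ‖z‖ - 3) ^ 2 := by positivity
    _ = 4 * t ^ 3 * ‖z‖ ^ 4 + 36 * t * ‖z‖ ^ 2 - 24 * t ^ 2 * ‖z‖ ^ 3 := by ring
    _ ≤ 4 * t ^ 3 * ‖z‖ ^ 4 + 36 * t * ‖z‖ ^ 2 - 24 * t ^ 2 * (z ^ 3).re := by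
      gcongr
      exact re_pow_le_norm_pow z 3

theorem neg_twenty_seven_le_deltoidP (p : ℝ × ℝ) : -27 ≤ deltoidP p := by
  simpa [deltoidP] using monotoneOn_deltoidP_ray p self_mem_Ici (mem_Ici.2 zero_le_one) zero_le_one

theorem deltoidP_le_smul (p : ℝ × ℝ) {t : ℝ} (ht : 1 ≤ t) : deltoidP p ≤ deltoidP (t • p) := by
  simpa using monotoneOn_deltoidP_ray p (mem_Ici.2 zero_le_one)
    (mem_Ici.2 (zero_le_one.trans ht)) ht

theorem norm_lt_three_of_deltoidP_neg {z : ℂ} (hz : deltoidP (z.re, z.im) < 0) : ‖z‖ < 3 := by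
  by_contra! hge
  have hcusp : 0 ≤ (‖z‖ - 3) ^ 3 * (‖z‖ + 1) :=
    mul_nonneg (pow_nonneg (sub_nonneg.2 hge) 3) (by positivity)
  rw [deltoidP_re_im] at hz
  linarith [re_pow_le_norm_pow z 3]

theorem isBounded_setOf_deltoidP_neg : Bornology.IsBounded {p | deltoidP p < 0} := by
  refine (Metric.isBounded_ball (x := (0 : ℝ × ℝ)) (r := 3)).subset fun p hp => ?_
  have hnorm : ‖(⟨p.1, p.2⟩ : ℂ)‖ < 3 := norm_lt_three_of_deltoidP_neg hp
  exact mem_ball_zero_iff.2 (max_lt ((Complex.abs_re_le_norm _).trans_lt hnorm)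
    ((Complex.abs_im_le_norm _).trans_lt hnorm))

theorem deltoidInterior_eq_setOf_neg : deltoidInterior = {p | deltoidP p < 0} := by
  ext p
  constructor
  · rintro ⟨hoff : deltoidP p ≠ 0, hbdd⟩
    by_contra hnot_neg
    have hpos : 0 < deltoidP p := hoff.symm.lt_of_le (not_lt.1 hnot_neg)
    have hp_ne : p ≠ 0 := by
      rintro rfl
      norm_num [deltoidP] at hpos
    exact not_isBounded_connectedComponentIn_of_ray hp_ne
      (fun t ht => (hpos.trans_le (deltoidP_le_smul p ht)).ne') hbdd
  · intro hp
    exact ⟨ne_of_lt hp, isBounded_setOf_deltoidP_neg.subset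
      (connectedComponentIn_subset_setOf_lt continuous_deltoidP.continuousOn hp)⟩

end DeltoidPolynomial

section DeltoidSlices

/-- Half the length of the vertical slice at abscissa `x` of the interior of the deltoid, for
`0 ≤ x ≤ 3`. On the curve `x = 2 cos θ + cos 2θ` gives `√(2x + 3) = |2 cos θ + 1|`, and for
`2 cos θ + 1 ≥ 0` the formula is `|2 sin θ - sin 2θ|` written in terms of `√(2x + 3)`. -/
noncomputable def deltoidHalfWidth (x : ℝ) : ℝ :=
  √((3 - √(2 * x + 3)) ^ 3 * (√(2 * x + 3) + 1)) / 2

@[fun_prop]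
theorem measurable_deltoidHalfWidth : Measurable deltoidHalfWidth := by
  unfold deltoidHalfWidth
  fun_prop

variable {x y : ℝ}

theorem sqrt_two_mul_add_three_le (hx : x ≤ 3) : √(2 * x + 3) ≤ 3 :=
  Real.sqrt_le_iff.2 ⟨by norm_num, by linarith⟩

theorem deltoidHalfWidth_sq (hx : x ≤ 3) :
    deltoidHalfWidth x ^ 2 = (3 - √(2 * x + 3)) ^ 3 * (√(2 * x + 3) + 1) / 4 := by
  have hm : 0 ≤ 3 - √(2 * x + 3) := sub_nonneg.2 (sqrt_two_mul_add_three_le hx)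
  rw [deltoidHalfWidth, div_pow, Real.sq_sqrt (by positivity)]
  norm_num

theorem deltoidHalfWidth_nonneg (x : ℝ) : 0 ≤ deltoidHalfWidth x := by
  unfold deltoidHalfWidth
  positivity

theorem neg_deltoidP_eq_mul (hx : x ∈ Icc (-3 / 2) 3) (y : ℝ) :
    -deltoidP (x, y) = (deltoidHalfWidth x ^ 2 - y ^ 2) *
      (y ^ 2 + (√(2 * x + 3) + 3) ^ 3 * (√(2 * x + 3) - 1) / 4) := by
  rw [deltoidHalfWidth_sq hx.2]
  have hm : √(2 * x + 3) ^ 2 = 2 * x + 3 := Real.sq_sqrt (by linarith [hx.1])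
  generalize √(2 * x + 3) = m at hm ⊢
  obtain rfl : x = (m ^ 2 - 3) / 2 := by linarith
  simp only [deltoidP]
  ring

theorem one_le_deltoidP_cofactor (hx : 0 ≤ x) :
    1 ≤ y ^ 2 + (√(2 * x + 3) + 3) ^ 3 * (√(2 * x + 3) - 1) / 4 := by
  have hm : 3 / 2 ≤ √(2 * x + 3) := Real.le_sqrt_of_sq_le (by linarith)
  have hcube : 3 ^ 3 ≤ (√(2 * x + 3) + 3) ^ 3 := by gcongr; linarith
  nlinarith [sq_nonneg y]

theorem deltoidP_neg_iff (hx : x ∈ Icc 0 3) :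
    deltoidP (x, y) < 0 ↔ y ∈ Ioo (-deltoidHalfWidth x) (deltoidHalfWidth x) := by
  have hcofactor := one_le_deltoidP_cofactor (y := y) hx.1
  rw [← neg_pos, neg_deltoidP_eq_mul ⟨by linarith [hx.1], hx.2⟩,
    mul_pos_iff_of_pos_right (by linarith), sub_pos, sq_lt_sq,
    abs_of_nonneg (deltoidHalfWidth_nonneg x), abs_lt, mem_Ioo]

theorem sq_sub_sq_le_neg_deltoidP (hx : x ∈ Icc 0 3) (hy : deltoidP (x, y) < 0) :
    deltoidHalfWidth x ^ 2 - y ^ 2 ≤ -deltoidP (x, y) := by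
  have hcofactor := one_le_deltoidP_cofactor (y := y) hx.1
  have hslice := (deltoidP_neg_iff hx).1 hy
  rw [neg_deltoidP_eq_mul ⟨by linarith [hx.1], hx.2⟩]
  exact le_mul_of_one_le_right (sub_nonneg.2 (sq_lt_sq' hslice.1 hslice.2).le) hcofactor

theorem neg_deltoidP_le (hx : 0 ≤ x) (y : ℝ) : -deltoidP (x, y) ≤ 4 * (3 - x) ^ 3 := by
  have hexpand : -deltoidP (x, y) =
      4 * (3 - x) ^ 3 - (3 - x) ^ 4 - (2 * x ^ 2 + 24 * x + 18) * y ^ 2 - y ^ 4 := by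
    rw [deltoidP]
    ring
  have hlinear : 0 ≤ (2 * x ^ 2 + 24 * x + 18) * y ^ 2 := by positivity
  rw [hexpand]
  linarith [Even.pow_nonneg (n := 4) (by decide) (3 - x), Even.pow_nonneg (n := 4) (by decide) y]

theorem cube_le_deltoidHalfWidth_sq (hx : x ∈ Icc (-3 / 2) 3) :
    (3 - x) ^ 3 ≤ 27 * deltoidHalfWidth x ^ 2 := by
  rw [deltoidHalfWidth_sq hx.2]
  have hm_sq : √(2 * x + 3) ^ 2 = 2 * x + 3 := Real.sq_sqrt (by linarith [hx.1])
  have hm_le := sqrt_two_mul_add_three_le hx.2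
  have hm_nonneg := Real.sqrt_nonneg (2 * x + 3)
  set m := √(2 * x + 3)
  have hu : 3 - x = (3 - m) * (3 + m) / 2 := by linarith
  have hcube : (3 + m) ^ 3 ≤ 54 * (m + 1) := by
    linarith [mul_nonneg (sub_nonneg.2 hm_le) (by positivity : 0 ≤ m ^ 2 + 12 * m + 9)]
  calc (3 - x) ^ 3 = (3 - m) ^ 3 * (3 + m) ^ 3 / 8 := by rw [hu]; ring
    _ ≤ (3 - m) ^ 3 * (54 * (m + 1)) / 8 := by
      gcongr
    _ = 27 * ((3 - m) ^ 3 * (m + 1) / 4) := by ring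

theorem rpow_le_deltoidHalfWidth (hx : x ∈ Icc (-3 / 2) 3) :
    (3 - x) ^ (3 / 2 : ℝ) ≤ 6 * deltoidHalfWidth x := by
  have hu : 0 ≤ 3 - x := sub_nonneg.2 hx.2
  have hw := deltoidHalfWidth_nonneg x
  refine le_of_sq_le_sq ?_ (by positivity)
  calc ((3 - x) ^ (3 / 2 : ℝ)) ^ 2 = (3 - x) ^ 3 := by
        rw [← Real.rpow_mul_natCast hu, ← Real.rpow_natCast]
        norm_num
    _ ≤ 27 * deltoidHalfWidth x ^ 2 := cube_le_deltoidHalfWidth_sq hx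
    _ ≤ (6 * deltoidHalfWidth x) ^ 2 := by linarith [sq_nonneg (deltoidHalfWidth x)]

theorem deltoidHalfWidth_pos (hx : x ∈ Ico (-3 / 2) 3) : 0 < deltoidHalfWidth x := by
  have hpow : 0 < (3 - x) ^ (3 / 2 : ℝ) := Real.rpow_pos_of_pos (sub_pos.2 hx.2) _
  linarith [rpow_le_deltoidHalfWidth (Ico_subset_Icc_self hx)]

/-- The part of the interior of the deltoid in the half-plane `0 ≤ x₁`, described by its vertical
slices; by symmetry under rotation by `2π / 3` it decides integrability over the whole interior. -/
def deltoidRightHalf : Set (ℝ × ℝ) :=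
  regionBetween (-deltoidHalfWidth) deltoidHalfWidth (Ico 0 3)

theorem measurableSet_deltoidRightHalf : MeasurableSet deltoidRightHalf :=
  measurableSet_regionBetween measurable_deltoidHalfWidth.neg measurable_deltoidHalfWidth
    measurableSet_Ico

theorem deltoidRightHalf_eq : deltoidRightHalf = {p | deltoidP p < 0} ∩ {p | 0 ≤ p.1} := by
  ext p
  constructor
  · rintro ⟨hx, hy⟩
    exact ⟨(deltoidP_neg_iff (Ico_subset_Icc_self hx)).2 hy, hx.1⟩
  · rintro ⟨hneg, hx_nonneg⟩
    have hx_lt : p.1 < 3 :=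
      (Complex.re_le_norm ⟨p.1, p.2⟩).trans_lt (norm_lt_three_of_deltoidP_neg hneg)
    exact ⟨⟨hx_nonneg, hx_lt⟩, (deltoidP_neg_iff ⟨hx_nonneg, hx_lt.le⟩).1 hneg⟩

end DeltoidSlices

section Integrability

variable {α β : ℝ}

theorem measurable_rpow_deltoidP (α : ℝ) : Measurable fun p => (-3 * deltoidP p) ^ α := by
  fun_prop

theorem measurableSet_setOf_deltoidP_neg : MeasurableSet {p | deltoidP p < 0} :=
  (isOpen_lt continuous_deltoidP continuous_const).measurableSet

theorem integrableOn_rpow_deltoidP_mono (hαβ : α ≤ β)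
    (hint : IntegrableOn (fun p => (-3 * deltoidP p) ^ α) {p | deltoidP p < 0}) :
    IntegrableOn (fun p => (-3 * deltoidP p) ^ β) {p | deltoidP p < 0} := by
  refine Integrable.mono' (hint.const_mul (81 ^ (β - α)))
    (measurable_rpow_deltoidP β).aestronglyMeasurable
    (ae_restrict_of_forall_mem measurableSet_setOf_deltoidP_neg fun p (hp : deltoidP p < 0) => ?_)
  have hpos : 0 < -3 * deltoidP p := by linarith
  rw [Real.norm_of_nonneg (by positivity)]
  calc (-3 * deltoidP p) ^ β = (-3 * deltoidP p) ^ (β - α) * (-3 * deltoidP p) ^ α := by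
        rw [← Real.rpow_add hpos, sub_add_cancel]
    _ ≤ 81 ^ (β - α) * (-3 * deltoidP p) ^ α := by
        gcongr
        linarith [neg_twenty_seven_le_deltoidP p]

theorem integrableOn_deltoidHalfWidth_rpow (hα : -(5 / 6) < α) (hα' : α ≤ -(1 / 2)) :
    IntegrableOn (fun x => deltoidHalfWidth x ^ (2 * α + 1)) (Ico 0 3) := by
  have hcusp : IntegrableOn (fun x : ℝ => (3 - x) ^ (3 / 2 * (2 * α + 1))) (Ico 0 3) :=
    (integrableOn_Ico_sub_rpow_iff (by norm_num)).2 (by linarith)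
  refine Integrable.mono' (hcusp.const_mul ((6 : ℝ)⁻¹ ^ (2 * α + 1)))
    (Measurable.aestronglyMeasurable (by fun_prop))
    (ae_restrict_of_forall_mem measurableSet_Ico fun x hx => ?_)
  have hu : 0 < 3 - x := sub_pos.2 hx.2
  rw [Real.norm_of_nonneg (Real.rpow_nonneg (deltoidHalfWidth_nonneg x) _), Real.rpow_mul hu.le,
    ← Real.mul_rpow (by norm_num) (by positivity)]
  refine Real.rpow_le_rpow_of_nonpos (by positivity) ?_ (by linarith)
  linarith [rpow_le_deltoidHalfWidth (x := x) ⟨by linarith [hx.1], hx.2.le⟩]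

theorem integrableOn_deltoidRightHalf_rpow (hα : -(5 / 6) < α) (hα' : α ≤ -(1 / 2)) :
    IntegrableOn (fun p => (-3 * deltoidP p) ^ α) deltoidRightHalf := by
  have hmodel : IntegrableOn (fun p : ℝ × ℝ => (deltoidHalfWidth p.1 ^ 2 - p.2 ^ 2) ^ α)
      deltoidRightHalf :=
    integrableOn_regionBetween_rpow_sq_sub_sq measurableSet_Ico measurable_deltoidHalfWidth
      (fun x hx => deltoidHalfWidth_pos ⟨by linarith [hx.1], hx.2⟩) (by linarith)
      (integrableOn_deltoidHalfWidth_rpow hα hα')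
  refine Integrable.mono' hmodel (measurable_rpow_deltoidP α).aestronglyMeasurable
    (ae_restrict_of_forall_mem measurableSet_deltoidRightHalf fun p hp => ?_)
  have hx := Ico_subset_Icc_self hp.1
  have hneg : deltoidP p < 0 := (deltoidP_neg_iff hx).2 hp.2
  rw [Real.norm_of_nonneg (Real.rpow_nonneg (by linarith) _)]
  refine Real.rpow_le_rpow_of_nonpos (sub_pos.2 (sq_lt_sq' hp.2.1 hp.2.2)) ?_ (by linarith)
  linarith [sq_sub_sq_le_neg_deltoidP hx hneg]

theorem integrableOn_rpow_deltoidP_of_rightHalf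
    (hint : IntegrableOn (fun p => (-3 * deltoidP p) ^ α) deltoidRightHalf) :
    IntegrableOn (fun p => (-3 * deltoidP p) ^ α) {p | deltoidP p < 0} := by
  let e := Complex.measurableEquivRealProd
  have he : MeasurePreserving e := Complex.volume_preserving_equiv_real_prod
  have hζ := Complex.isPrimitiveRoot_exp 3 three_ne_zero
  rw [← integrable_indicator_iff measurableSet_setOf_deltoidP_neg]
  refine (he.integrable_comp_emb e.measurableEmbedding).1
    (integrable_of_integrableOn_re_nonneg hζ (by norm_num) (fun z => ?_) ?_)
  · simp only [e, Function.comp_apply, Complex.measurableEquivRealProd_apply, indicator,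
      mem_ofPred_eq, deltoidP_re_im_mul_of_cube_eq_one hζ.pow_eq_one]
    rfl
  · refine (he.integrableOn_comp_preimage e.measurableEmbedding (s := {p | 0 ≤ p.1})).2 ?_
    rw [integrableOn_indicator_iff measurableSet_setOf_deltoidP_neg, ← deltoidRightHalf_eq]
    exact hint

theorem rpow_le_mul_rpow_deltoidP {x y : ℝ} (hx : x ∈ Icc 0 3) (hneg : deltoidP (x, y) < 0) :
    (3 - x) ^ (-(5 / 2) : ℝ) ≤ 12 ^ (5 / 6 : ℝ) * (-3 * deltoidP (x, y)) ^ (-(5 / 6) : ℝ) := by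
  have hu : 0 ≤ 3 - x := sub_nonneg.2 hx.2
  have hP_le := neg_deltoidP_le hx.1 y
  calc (3 - x) ^ (-(5 / 2) : ℝ) = ((3 - x) ^ 3) ^ (-(5 / 6) : ℝ) := by
        rw [← Real.rpow_natCast_mul hu]
        norm_num
    _ = 12 ^ (5 / 6 : ℝ) * (12 * (3 - x) ^ 3) ^ (-(5 / 6) : ℝ) := by
        rw [Real.mul_rpow (by norm_num) (by positivity), ← mul_assoc,
          ← Real.rpow_add (by norm_num), add_neg_cancel, Real.rpow_zero, one_mul]
    _ ≤ 12 ^ (5 / 6 : ℝ) * (-3 * deltoidP (x, y)) ^ (-(5 / 6) : ℝ) := by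
        refine mul_le_mul_of_nonneg_left ?_ (by positivity)
        exact Real.rpow_le_rpow_of_nonpos (by linarith) (by linarith) (by norm_num)

theorem not_integrableOn_deltoidRightHalf_critical :
    ¬ IntegrableOn (fun p => (-3 * deltoidP p) ^ (-(5 / 6) : ℝ)) deltoidRightHalf := by
  intro hint
  have hcusp : IntegrableOn (fun p : ℝ × ℝ => (3 - p.1) ^ (-(5 / 2) : ℝ)) deltoidRightHalf := by
    refine Integrable.mono' (hint.const_mul (12 ^ (5 / 6 : ℝ)))
      (Measurable.aestronglyMeasurable (by fun_prop))
      (ae_restrict_of_forall_mem measurableSet_deltoidRightHalf fun p hp => ?_)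
    have hx := Ico_subset_Icc_self hp.1
    rw [Real.norm_of_nonneg (Real.rpow_nonneg (sub_nonneg.2 hx.2) _)]
    exact rpow_le_mul_rpow_deltoidP hx ((deltoidP_neg_iff hx).2 hp.2)
  have hslices := integrableOn_sub_mul_of_integrableOn_regionBetween
    (g := fun x => (3 - x) ^ (-(5 / 2) : ℝ)) measurable_deltoidHalfWidth.neg
    measurable_deltoidHalfWidth measurableSet_Ico
    (fun x _ => neg_le_self (deltoidHalfWidth_nonneg x)) hcusp
  have hinv : IntegrableOn (fun x : ℝ => (3 - x) ^ (-1 : ℝ)) (Ico 0 3) := by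
    refine Integrable.mono' (hslices.const_mul 3) (Measurable.aestronglyMeasurable (by fun_prop))
      (ae_restrict_of_forall_mem measurableSet_Ico fun x hx => ?_)
    have hu : 0 < 3 - x := sub_pos.2 hx.2
    rw [Real.norm_of_nonneg (by positivity), Real.norm_of_nonneg (by positivity), Pi.neg_apply]
    calc (3 - x) ^ (-1 : ℝ) = (3 - x) ^ (3 / 2 : ℝ) * (3 - x) ^ (-(5 / 2) : ℝ) := by
          rw [← Real.rpow_add hu]
          norm_num
      _ ≤ 6 * deltoidHalfWidth x * (3 - x) ^ (-(5 / 2) : ℝ) := by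
          gcongr
          exact rpow_le_deltoidHalfWidth ⟨by linarith [hx.1], hx.2.le⟩
      _ = 3 * ((deltoidHalfWidth x - -deltoidHalfWidth x) * (3 - x) ^ (-(5 / 2) : ℝ)) := by ring
  exact lt_irrefl _ ((integrableOn_Ico_sub_rpow_iff (by norm_num)).1 hinv)

theorem integrableOn_rpow_deltoidP_iff :
    IntegrableOn (fun p => (-3 * deltoidP p) ^ α) {p | deltoidP p < 0} ↔ -(5 / 6) < α := by
  constructor
  · intro hint
    by_contra! hα
    refine not_integrableOn_deltoidRightHalf_critical
      ((integrableOn_rpow_deltoidP_mono hα hint).mono_set ?_)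
    exact deltoidRightHalf_eq ▸ inter_subset_left
  · intro hα
    exact integrableOn_rpow_deltoidP_mono (min_le_left α (-(1 / 2)))
      (integrableOn_rpow_deltoidP_of_rightHalf (integrableOn_deltoidRightHalf_rpow
        (lt_min hα (by norm_num)) (min_le_right α (-(1 / 2)))))

end Integrability

theorem mainTheorem3 :
    (∀ x : ℝ × ℝ, (deltoidG x).det = -3 * deltoidP x) ∧
    (∀ x ∈ deltoidInterior, 0 < (deltoidG x).det) ∧
    (∀ α : ℝ,
      MeasureTheory.IntegrableOn (fun x : ℝ × ℝ => (deltoidG x).det ^ α) deltoidInterior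
        MeasureTheory.volume ↔ -(5 / 6 : ℝ) < α) := by
  refine ⟨deltoidG_det, fun x hx => ?_, fun α => ?_⟩
  · have hneg : deltoidP x < 0 := deltoidInterior_eq_setOf_neg.subset hx
    rw [deltoidG_det]
    linarith
  · simp only [deltoidG_det, deltoidInterior_eq_setOf_neg]
    exact integrableOn_rpow_deltoidP_iff
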